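/- Let $G$ be an infinite, connected, locally finite graph without loops or multiple edges, with Laplacian $\Delta f(x)=\sum_{y\sim x}(f(x)-f(y))$. Let $p_t(x,y)$ be its (minimal) heat kernel, i.e. the supremum over all finite sets $D$ of vertices (equivalently, the limit along any exhaustion by finite sets) of the kernels of $e^{-t\Delta_D}$, extended by zero, where $\Delta_D$ is the restriction of $\Delta$ to $D$ with Dirichlet boundary conditions. Call $G$ stochastically incomplete if $\sum_y p_t(x,y)<1$ for some $t>0$ and some vertex $x$. Fix a vertex $x_0$. For $r\ge 0$ let $S(r)$ be the number of vertices at distance exactly $r$ from $x_0$ and $V(r)=\sum_{i=0}^r S(i)$. Suppose that $G$ is spherically symmetric about $x_0$: there are functions $k_\pm$ of $r$ such that every vertex $x$ at distance $r$ from $x_0$ has exactly $k_+(r)$ neighbours at distance $r+1$ from $x_0$ and exactly $k_-(r)$ neighbours at distance $r-1$ from $x_0$ (no assumption is made on the number of neighbours at distance $r$). Then $G$ is stochastically incomplete if and only if $$\sum_{r=0}^\infty \frac{V(r)}{k_+(r)\,S(r)}<\infty .$$ -/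

import Mathlib

open scoped ENNReal

namespace SimpleGraph

variable {V : Type*}

/-- The (positive) graph Laplacian `Δ f (x) = ∑_{y ∼ x} (f x - f y)` on a locally finite graph. -/
noncomputable def laplacian (G : SimpleGraph V) [G.LocallyFinite] (f : V → ℝ) (x : V) : ℝ :=
  ∑ y ∈ G.neighborFinset x, (f x - f y)

open scoped Classical in
/-- The Laplacian with Dirichlet boundary conditions on a finite set `D` of vertices: `Δ` acting on
the functions that vanish outside `D`, followed by restriction to `D`, as a matrix indexed by `D`
(column `y` is `Δ` of the indicator function of `y`). -/
noncomputable def dirichletLaplacian (G : SimpleGraph V) [G.LocallyFinite] (D : Finset V) :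
    Matrix D D ℝ :=
  Matrix.of fun x y => G.laplacian (Pi.single (y : V) (1 : ℝ)) (x : V)

open scoped Classical in
/-- The Dirichlet heat kernel of a finite set `D`: the kernel of `exp (-t Δ_D)`, extended by zero
to all pairs of vertices. -/
noncomputable def dirichletHeatKernel (G : SimpleGraph V) [G.LocallyFinite] (D : Finset V)
    (t : ℝ) (x y : V) : ℝ :=
  if h : x ∈ D ∧ y ∈ D then
    (NormedSpace.exp (-(t • G.dirichletLaplacian D)) : Matrix D D ℝ) ⟨x, h.1⟩ ⟨y, h.2⟩
  else 0

/-- The (minimal) heat kernel `p_t(x, y)`, constructed by exhaustion. For `t ≥ 0` the Dirichlet heat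
kernels are non-negative and increase with the finite set `D`, so their limit along any exhaustion
of the graph by finite sets is the supremum over all finite sets. -/
noncomputable def heatKernel (G : SimpleGraph V) [G.LocallyFinite] (t : ℝ) (x y : V) : ℝ≥0∞ :=
  ⨆ D : Finset V, ENNReal.ofReal (G.dirichletHeatKernel D t x y)

/-- Stochastic incompleteness: the total mass of the heat kernel is less than one for some time
`t > 0` and some starting vertex. -/
def StochasticallyIncomplete (G : SimpleGraph V) [G.LocallyFinite] : Prop :=
  ∃ t : ℝ, 0 < t ∧ ∃ x : V, ∑' y : V, G.heatKernel t x y < 1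

/-- The number `m₊(x)` of neighbours of `x` one step further from `x₀` than `x`. -/
noncomputable def outerDegree (G : SimpleGraph V) (x₀ x : V) : ℕ :=
  {y : V | G.Adj x y ∧ G.dist x₀ y = G.dist x₀ x + 1}.ncard

/-- The number `m₋(x)` of neighbours of `x` one step closer to `x₀` than `x`. -/
noncomputable def innerDegree (G : SimpleGraph V) (x₀ x : V) : ℕ :=
  {y : V | G.Adj x y ∧ G.dist x₀ y + 1 = G.dist x₀ x}.ncard

/-- `G` is spherically symmetric about `x₀` with `m₊(x) = k₊(r)` and `m₋(x) = k₋(r)` for every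
vertex `x` at distance `r` from `x₀`. Nothing is asked of the edges inside the spheres. -/
def IsSphericallySymmetric (G : SimpleGraph V) (x₀ : V) (kPlus kMinus : ℕ → ℕ) : Prop :=
  ∀ x : V, G.outerDegree x₀ x = kPlus (G.dist x₀ x) ∧ G.innerDegree x₀ x = kMinus (G.dist x₀ x)

/-- `S(r)`: the number of vertices at distance exactly `r` from `x₀`. -/
noncomputable def sphereArea (G : SimpleGraph V) (x₀ : V) (r : ℕ) : ℕ :=
  {x : V | G.dist x₀ x = r}.ncard

/-- `V(r) = S(0) + ⋯ + S(r)`: the number of vertices at distance at most `r` from `x₀`. -/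
noncomputable def ballVolume (G : SimpleGraph V) (x₀ : V) (r : ℕ) : ℕ :=
  ∑ i ∈ Finset.range (r + 1), G.sphereArea x₀ i

end SimpleGraph

/-!
If `Δ v = -1` then `s + v` solves the heat equation, so affine functions of `s + v` can be compared
with the Dirichlet heat semigroups to estimate their mass. If `v ≤ M`, the mass at time `T` is at
most `(M - v x) / T`, hence below one for large `T`. If `v` tends to infinity, the mass on the
finite set `{v < min v + R}` is at least `1 - O(1 / R)`, hence equal to one in the limit. On a
spherically symmetric graph the radial function with increments `V(r) / (k₊(r) S(r))` is such a `v`: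
the flux of `v` out of a ball is then the volume of the ball. It is bounded if the series converges
and tends to infinity otherwise.
-/

open Filter Set Matrix Topology
open NormedSpace (exp)

namespace StochasticCompleteness

section MatrixExponential

variable {m n : Type*} [Fintype m] [DecidableEq m] [Fintype n] [DecidableEq n]

theorem submatrix_pow_apply_le {R : Type*} [Semiring R] [PartialOrder R] [IsOrderedRing R]
    {B : Matrix m m R} (hB : ∀ i j, 0 ≤ B i j) (e : n ↪ m) (k : ℕ) (i j : n) :
    (B.submatrix e e ^ k) i j ≤ (B ^ k) (e i) (e j) := by
  induction k generalizing j with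
  | zero => simp [one_apply]
  | succ k ih =>
    rw [pow_succ, mul_apply, pow_succ, mul_apply]
    calc ∑ l, (B.submatrix e e ^ k) i l * B (e l) (e j)
        ≤ ∑ l, (B ^ k) (e i) (e l) * B (e l) (e j) :=
          Finset.sum_le_sum fun l _ => mul_le_mul_of_nonneg_right (ih l) (hB _ _)
      _ = ∑ l ∈ Finset.univ.map e, (B ^ k) (e i) l * B l (e j) := by rw [Finset.sum_map]
      _ ≤ ∑ l, (B ^ k) (e i) l * B l (e j) :=
          Finset.sum_le_sum_of_subset_of_nonneg (Finset.subset_univ _) fun l _ _ =>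
            mul_nonneg (pow_apply_nonneg hB k _ _) (hB _ _)

theorem exp_eq_smul_exp_add_smul_one (A : Matrix m m ℝ) (c : ℝ) :
    exp A = Real.exp (-c) • exp (A + c • (1 : Matrix m m ℝ)) := by
  have hc : exp (-c • (1 : Matrix m m ℝ)) = Real.exp (-c) • (1 : Matrix m m ℝ) := by
    rw [smul_one_eq_diagonal, exp_diagonal, Pi.exp_def, smul_one_eq_diagonal, Real.exp_eq_exp_ℝ]
  rw [← mul_one (exp (A + _)), ← mul_smul_comm, ← hc,
    ← exp_add_of_commute _ _ ((Commute.one_right _).smul_right _), neg_smul, add_neg_cancel_right]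

theorem hasSum_exp_apply (B : Matrix m m ℝ) (i j : m) :
    HasSum (fun k : ℕ => (k.factorial : ℝ)⁻¹ * (B ^ k) i j) (exp B i j) :=
  open scoped Norms.Operator in (NormedSpace.exp_series_hasSum_exp' (𝕂 := ℝ) B).mapL
    (LinearMap.toContinuousLinearMap (entryLinearMap ℝ ℝ i j))

theorem hasDerivAt_exp_smul_mulVec (A : Matrix m m ℝ) {w : ℝ → m → ℝ} {w' : m → ℝ} (T s : ℝ)
    (hw : HasDerivAt w w' s) :
    HasDerivAt (fun s => exp ((T - s) • A) *ᵥ w s)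
      (exp ((T - s) • A) *ᵥ (w' - A *ᵥ w s)) s := by
  open scoped Norms.Operator in
  have hexp : HasDerivAt (fun s => exp ((T - s) • A))
      (-(exp ((T - s) • A) * A)) s := by
    simpa using! (hasDerivAt_exp_smul_const (𝕂 := ℝ) A (T - s)).scomp s
      ((hasDerivAt_id s).const_sub T)
  refine ((mulVecBilin ℝ ℝ).toContinuousBilinearMap.hasDerivAt_of_bilinear
    (fun _ => hexp) fun _ => hw).congr_deriv ?_
  simp only [LinearMap.toContinuousBilinearMap_apply, mulVecBilin_apply]
  rw [mulVec_sub, mulVec_mulVec, neg_mulVec, ← sub_eq_add_neg]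

/-- A Metzler matrix: one whose off-diagonal entries are non-negative. These are the matrices whose
semigroup `exp (t A)`, `t ≥ 0`, preserves non-negative vectors. -/
def IsMetzler {m : Type*} (A : Matrix m m ℝ) : Prop :=
  Pairwise fun i j => 0 ≤ A i j

namespace IsMetzler

theorem smul {m : Type*} {A : Matrix m m ℝ} (hA : IsMetzler A) {t : ℝ} (ht : 0 ≤ t) :
    IsMetzler (t • A) :=
  fun _ _ hij => mul_nonneg ht (hA hij)

theorem exists_add_smul_one_nonneg {m : Type*} [Finite m] [DecidableEq m] {A : Matrix m m ℝ}
    (hA : IsMetzler A) :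
    ∃ c : ℝ, ∀ i j, 0 ≤ (A + c • (1 : Matrix m m ℝ)) i j := by
  obtain ⟨c, hc⟩ := (Set.finite_range fun i => -A i i).bddAbove
  refine ⟨c, fun i j => ?_⟩
  rcases eq_or_ne i j with rfl | hij
  · simpa [add_comm] using neg_le_iff_add_nonneg.1 (hc (mem_range_self i))
  · simpa [one_apply_ne hij] using hA hij

variable {A : Matrix m m ℝ}

theorem exp_apply_nonneg (hA : IsMetzler A) (i j : m) : 0 ≤ exp A i j := by
  obtain ⟨c, hc⟩ := hA.exists_add_smul_one_nonneg
  rw [exp_eq_smul_exp_add_smul_one A c]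
  exact mul_nonneg (Real.exp_nonneg _) ((hasSum_exp_apply _ i j).nonneg fun k =>
    mul_nonneg (by positivity) (pow_apply_nonneg hc k i j))

theorem exp_submatrix_apply_le (hA : IsMetzler A) (e : n ↪ m) (i j : n) :
    exp (A.submatrix e e) i j ≤ exp A (e i) (e j) := by
  obtain ⟨c, hc⟩ := hA.exists_add_smul_one_nonneg
  have hsub : A.submatrix e e + c • 1 = (A + c • 1).submatrix e e := by
    simp [submatrix_add, submatrix_smul, submatrix_one_embedding]
  rw [exp_eq_smul_exp_add_smul_one A c, exp_eq_smul_exp_add_smul_one (A.submatrix e e) c, hsub]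
  refine mul_le_mul_of_nonneg_left ?_ (Real.exp_nonneg _)
  exact hasSum_le (fun k => mul_le_mul_of_nonneg_left (submatrix_pow_apply_le hc e k i j)
    (by positivity)) (hasSum_exp_apply _ i j) (hasSum_exp_apply _ _ _)

theorem le_exp_mulVec_of_deriv_le (hA : IsMetzler A) {w w' : ℝ → m → ℝ} {T : ℝ} (hT : 0 ≤ T)
    (hw : ∀ s ∈ Icc 0 T, HasDerivAt w (w' s) s) (hle : ∀ s ∈ Icc 0 T, w' s ≤ A *ᵥ w s) :
    w T ≤ exp (T • A) *ᵥ w 0 := by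
  intro i
  -- Duhamel interpolation: `s ↦ exp ((T - s) A) (w s)` decreases from the right-hand side to `w T`
  have hderiv : ∀ s ∈ Icc 0 T, HasDerivAt (fun s => (exp ((T - s) • A) *ᵥ w s) i)
      ((exp ((T - s) • A) *ᵥ (w' s - A *ᵥ w s)) i) s := fun s hs =>
    hasDerivAt_pi.1 (hasDerivAt_exp_smul_mulVec A T s (hw s hs)) i
  have hanti : AntitoneOn (fun s => (exp ((T - s) • A) *ᵥ w s) i) (Icc 0 T) := by
    refine antitoneOn_of_hasDerivWithinAt_nonpos (convex_Icc 0 T)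
      (fun s hs => (hderiv s hs).continuousAt.continuousWithinAt)
      (fun s hs => (hderiv s (interior_subset hs)).hasDerivWithinAt) fun s hs => ?_
    have hs' := interior_subset hs
    exact Finset.sum_nonpos fun j _ => mul_nonpos_of_nonneg_of_nonpos
      ((hA.smul (sub_nonneg.2 hs'.2)).exp_apply_nonneg i j) (sub_nonpos.2 (hle s hs' j))
  simpa using hanti (left_mem_Icc.2 hT) (right_mem_Icc.2 hT) hT

end IsMetzler

end MatrixExponential

section HeatKernel

variable {V : Type*} {G : SimpleGraph V} [G.LocallyFinite]

theorem laplacian_le_laplacian {f g : V → ℝ} {x : V} (hx : f x = g x) (h : f ≤ g) :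
    G.laplacian g x ≤ G.laplacian f x :=
  Finset.sum_le_sum fun y _ => sub_le_sub hx.ge (h y)

theorem laplacian_const_add_const_mul (a b : ℝ) (f : V → ℝ) (x : V) :
    G.laplacian (fun y => a + b * f y) x = b * G.laplacian f x := by
  simp only [SimpleGraph.laplacian, add_sub_add_left_eq_sub, ← mul_sub, Finset.mul_sum]

open scoped Classical in
theorem dirichletLaplacian_mulVec (D : Finset V) (f : V → ℝ) (x : D) :
    (G.dirichletLaplacian D *ᵥ fun y : D => f y) x
      = G.laplacian (indicator (D : Set V) f) x := by
  have hf (z : V) : indicator (D : Set V) f z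
      = ∑ y : D, (Pi.single (y : V) (1 : ℝ) : V → ℝ) z * f y := by
    rw [Finset.sum_coe_sort D fun y => (Pi.single y (1 : ℝ) : V → ℝ) z * f y]
    simp [Pi.single_apply, indicator_apply]
  simp only [mulVec, dotProduct, SimpleGraph.dirichletLaplacian, of_apply, SimpleGraph.laplacian,
    hf, Finset.sum_mul, sub_mul, ← Finset.sum_sub_distrib]
  exact Finset.sum_comm

theorem isMetzler_neg_dirichletLaplacian (D : Finset V) :
    IsMetzler (-G.dirichletLaplacian D) := by
  classical
  intro i j hij
  have hij' : (i : V) ≠ j := Subtype.coe_ne_coe.2 hij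
  rw [neg_apply, neg_nonneg]
  refine Finset.sum_nonpos fun y _ => ?_
  rw [Pi.single_eq_of_ne hij', zero_sub, neg_nonpos]
  exact (Pi.single_nonneg (α := fun _ => ℝ)).2 zero_le_one y

open scoped Classical in
theorem dirichletHeatKernel_of_mem {D : Finset V} (t : ℝ) {x y : V} (hx : x ∈ D) (hy : y ∈ D) :
    G.dirichletHeatKernel D t x y
      = exp (t • -G.dirichletLaplacian D) ⟨x, hx⟩ ⟨y, hy⟩ := by
  rw [SimpleGraph.dirichletHeatKernel, dif_pos ⟨hx, hy⟩, smul_neg]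

theorem dirichletHeatKernel_nonneg (D : Finset V) {t : ℝ} (ht : 0 ≤ t) (x y : V) :
    0 ≤ G.dirichletHeatKernel D t x y := by
  classical
  by_cases h : x ∈ D ∧ y ∈ D
  · rw [dirichletHeatKernel_of_mem t h.1 h.2]
    exact ((isMetzler_neg_dirichletLaplacian D).smul ht).exp_apply_nonneg _ _
  · rw [SimpleGraph.dirichletHeatKernel, dif_neg h]

theorem dirichletHeatKernel_mono {t : ℝ} (ht : 0 ≤ t) (x y : V) :
    Monotone fun D => G.dirichletHeatKernel D t x y := by
  classical
  intro D D' hD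
  beta_reduce
  by_cases h : x ∈ D ∧ y ∈ D
  · rw [dirichletHeatKernel_of_mem t h.1 h.2, dirichletHeatKernel_of_mem t (hD h.1) (hD h.2)]
    exact ((isMetzler_neg_dirichletLaplacian D').smul ht).exp_submatrix_apply_le
      (Subtype.impEmbedding (· ∈ D) (· ∈ D') hD) ⟨x, h.1⟩ ⟨y, h.2⟩
  · rw [SimpleGraph.dirichletHeatKernel, dif_neg h]
    exact dirichletHeatKernel_nonneg D' ht x y

open scoped Classical in
theorem sum_dirichletHeatKernel_mul {D : Finset V} (t : ℝ) (f : V → ℝ) {x : V} (hx : x ∈ D) :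
    ∑ y ∈ D, G.dirichletHeatKernel D t x y * f y
      = (exp (t • -G.dirichletLaplacian D) *ᵥ fun y : D => f y) ⟨x, hx⟩ := by
  rw [← Finset.sum_coe_sort]
  exact Finset.sum_congr rfl fun y _ => by rw [dirichletHeatKernel_of_mem t hx y.2]

theorem tsum_heatKernel {t : ℝ} (ht : 0 ≤ t) (x : V) :
    ∑' y, G.heatKernel t x y
      = ⨆ D : Finset V, ENNReal.ofReal (∑ y ∈ D, G.dirichletHeatKernel D t x y) := by
  classical
  have hnonneg (D : Finset V) (y : V) := dirichletHeatKernel_nonneg (G := G) D ht x y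
  have hmono (y : V) := dirichletHeatKernel_mono (G := G) ht x y
  rw [ENNReal.tsum_eq_iSup_sum]
  refine le_antisymm (iSup_le fun s => ?_) (iSup_mono fun D => ?_)
  · simp only [SimpleGraph.heatKernel]
    rw [ENNReal.finsetSum_iSup_of_monotone fun y D D' hD => ENNReal.ofReal_le_ofReal (hmono y hD)]
    refine iSup_le fun D => le_iSup_of_le (D ∪ s) ?_
    rw [← ENNReal.ofReal_sum_of_nonneg fun y _ => hnonneg D y]
    refine ENNReal.ofReal_le_ofReal ?_
    calc ∑ y ∈ s, G.dirichletHeatKernel D t x y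
        ≤ ∑ y ∈ s, G.dirichletHeatKernel (D ∪ s) t x y :=
          Finset.sum_le_sum fun y _ => hmono y Finset.subset_union_left
      _ ≤ ∑ y ∈ D ∪ s, G.dirichletHeatKernel (D ∪ s) t x y :=
          Finset.sum_le_sum_of_subset_of_nonneg Finset.subset_union_right fun y _ _ => hnonneg _ y
  · rw [ENNReal.ofReal_sum_of_nonneg fun y _ => hnonneg D y]
    exact Finset.sum_le_sum fun y _ =>
      le_iSup (fun D => ENNReal.ofReal (G.dirichletHeatKernel D t x y)) D

theorem le_sum_dirichletHeatKernel_mul_of_subsolution {D : Finset V} {u u' : ℝ → V → ℝ} {T : ℝ}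
    (hT : 0 ≤ T)
    (hderiv : ∀ s ∈ Icc 0 T, ∀ x ∈ D, HasDerivAt (fun s => u s x) (u' s x) s)
    (hsub : ∀ s ∈ Icc 0 T, ∀ x ∈ D, u' s x + G.laplacian (u s) x ≤ 0)
    (hboundary : ∀ s ∈ Icc 0 T, ∀ x ∉ D, u s x ≤ 0) (x : V) :
    u T x ≤ ∑ y ∈ D, G.dirichletHeatKernel D T x y * u 0 y := by
  classical
  by_cases hx : x ∈ D
  · rw [sum_dirichletHeatKernel_mul T (u 0) hx]
    refine (isMetzler_neg_dirichletLaplacian D).le_exp_mulVec_of_deriv_le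
      (w := fun s (y : D) => u s y) (w' := fun s y => u' s y) hT
      (fun s hs => hasDerivAt_pi.2 fun y => hderiv s hs y y.2) (fun s hs y => ?_) ⟨x, hx⟩
    have hle : u s ≤ indicator (D : Set V) (u s) :=
      le_indicator (fun _ _ => le_rfl) fun z hz => hboundary s hs z hz
    have hlap : G.laplacian (indicator (D : Set V) (u s)) y ≤ G.laplacian (u s) y :=
      laplacian_le_laplacian (indicator_of_mem y.2 _).symm hle
    rw [neg_mulVec, Pi.neg_apply, dirichletLaplacian_mulVec]
    linarith [hsub s hs y y.2]
  · simpa [SimpleGraph.dirichletHeatKernel, hx] using hboundary T (right_mem_Icc.2 hT) x hx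

end HeatKernel

section KhasminskiiCriteria

variable {V : Type*} {G : SimpleGraph V} [G.LocallyFinite] {v : V → ℝ}

theorem sum_dirichletHeatKernel_le_div {D : Finset V} {M T : ℝ} (hT : 0 < T)
    (hv : ∀ x ∈ D, G.laplacian v x ≤ -1) (hM : ∀ x, v x ≤ M) (x : V) :
    ∑ y ∈ D, G.dirichletHeatKernel D T x y ≤ (M - v x) / T := by
  let u : ℝ → V → ℝ := fun s y => (s - T - M) / T + 1 / T * v y
  have hu (s : ℝ) (y : V) : u s y = (s - T + (v y - M)) / T := by simp only [u]; ring
  have hcomp : u T x ≤ ∑ y ∈ D, G.dirichletHeatKernel D T x y * u 0 y := by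
    refine le_sum_dirichletHeatKernel_mul_of_subsolution (u' := fun _ _ => 1 / T) hT.le
      (fun s _ y _ => ?_) (fun s _ y hy => ?_) (fun s hs y _ => ?_) x
    · exact ((((hasDerivAt_id s).sub_const T).sub_const M).div_const T).add_const _
    · rw [laplacian_const_add_const_mul, ← mul_one_add]
      exact mul_nonpos_of_nonneg_of_nonpos (by positivity) (by linarith [hv y hy])
    · rw [hu]
      exact div_nonpos_of_nonpos_of_nonneg (by linarith [hs.2, hM y]) hT.le
  have hinit : ∑ y ∈ D, G.dirichletHeatKernel D T x y * u 0 y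
      ≤ ∑ y ∈ D, G.dirichletHeatKernel D T x y * (-1) := by
    refine Finset.sum_le_sum fun y _ => mul_le_mul_of_nonneg_left ?_
      (dirichletHeatKernel_nonneg D hT.le x y)
    rw [hu, div_le_iff₀ hT]
    linarith [hM y]
  rw [← Finset.sum_mul] at hinit
  have hfinal : u T x = -((M - v x) / T) := by rw [hu]; ring
  linarith

theorem one_sub_div_le_sum_dirichletHeatKernel {D : Finset V} {m R T : ℝ} (hT : 0 ≤ T) (hR : 0 < R)
    (hv : ∀ x ∈ D, -1 ≤ G.laplacian v x) (hm : ∀ x ∈ D, m ≤ v x) (hD : ∀ x ∉ D, m + R ≤ v x)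
    (x : V) : 1 - (T + v x - m) / R ≤ ∑ y ∈ D, G.dirichletHeatKernel D T x y := by
  let u : ℝ → V → ℝ := fun s y => (R + m - s) / R + -1 / R * v y
  have hu (s : ℝ) (y : V) : u s y = (R + m - s - v y) / R := by simp only [u]; ring
  have hcomp : u T x ≤ ∑ y ∈ D, G.dirichletHeatKernel D T x y * u 0 y := by
    refine le_sum_dirichletHeatKernel_mul_of_subsolution (u' := fun _ _ => -1 / R) hT
      (fun s _ y _ => ?_) (fun s _ y hy => ?_) (fun s hs y hy => ?_) x
    · exact (((hasDerivAt_id s).const_sub (R + m)).div_const R).add_const _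
    · rw [laplacian_const_add_const_mul, ← mul_one_add]
      exact mul_nonpos_of_nonpos_of_nonneg
        (div_nonpos_of_nonpos_of_nonneg (by norm_num) hR.le) (by linarith [hv y hy])
    · rw [hu]
      exact div_nonpos_of_nonpos_of_nonneg (by linarith [hs.1, hD y hy]) hR.le
  have hinit : ∑ y ∈ D, G.dirichletHeatKernel D T x y * u 0 y
      ≤ ∑ y ∈ D, G.dirichletHeatKernel D T x y := by
    refine Finset.sum_le_sum fun y hy =>
      mul_le_of_le_one_right (dirichletHeatKernel_nonneg D hT x y) ?_
    rw [hu, div_le_one hR]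
    linarith [hm y hy]
  calc 1 - (T + v x - m) / R = u T x := by rw [hu, one_sub_div hR.ne']; ring
    _ ≤ _ := hcomp.trans hinit

theorem stochasticallyIncomplete_of_laplacian_le_neg_one [Nonempty V]
    (hv : ∀ x, G.laplacian v x ≤ -1) (hbdd : BddAbove (range v)) :
    G.StochasticallyIncomplete := by
  obtain ⟨M, hM⟩ := hbdd
  obtain ⟨x⟩ := ‹Nonempty V›
  have hMx : 0 ≤ M - v x := sub_nonneg.2 (hM (mem_range_self x))
  have hT : 0 < M - v x + 1 := by linarith
  refine ⟨M - v x + 1, hT, x, ?_⟩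
  calc ∑' y, G.heatKernel (M - v x + 1) x y
      ≤ ENNReal.ofReal ((M - v x) / (M - v x + 1)) := by
        rw [tsum_heatKernel hT.le]
        exact iSup_le fun D => ENNReal.ofReal_le_ofReal <|
          sum_dirichletHeatKernel_le_div hT (fun y _ => hv y) (fun y => hM (mem_range_self y)) x
    _ < 1 := ENNReal.ofReal_lt_one.2 ((div_lt_one hT).2 (lt_add_one _))

theorem not_stochasticallyIncomplete_of_neg_one_le_laplacian
    (hv : ∀ x, -1 ≤ G.laplacian v x) (hproper : Tendsto v cofinite atTop) :
    ¬G.StochasticallyIncomplete := by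
  rintro ⟨t, ht, x, hlt⟩
  have : Nonempty V := ⟨x⟩
  obtain ⟨z, hz⟩ := hproper.exists_forall_le
  have hlim : Tendsto (fun R => ENNReal.ofReal (1 - (t + v x - v z) / R)) atTop (𝓝 1) := by
    simpa using ENNReal.tendsto_ofReal ((tendsto_const_nhds (x := (1 : ℝ))).sub
      ((tendsto_const_nhds (x := t + v x - v z)).div_atTop tendsto_id))
  refine hlt.not_ge (le_of_tendsto hlim ?_)
  filter_upwards [eventually_gt_atTop 0] with R hR
  have hfin : {y | ¬v z + R ≤ v y}.Finite :=
    eventually_cofinite.1 (hproper.eventually_ge_atTop (v z + R))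
  rw [tsum_heatKernel ht.le]
  refine le_iSup_of_le hfin.toFinset (ENNReal.ofReal_le_ofReal ?_)
  exact one_sub_div_le_sum_dirichletHeatKernel ht.le hR (fun y _ => hv y) (fun y _ => hz y)
    (fun y hy => by simpa using hy) x

end KhasminskiiCriteria

section Spheres

variable {V : Type*} {G : SimpleGraph V} {x₀ : V}

theorem exists_adj_dist_eq_of_dist_eq_succ {y : V} {r : ℕ} (h : G.dist x₀ y = r + 1) :
    ∃ z, G.Adj z y ∧ G.dist x₀ z = r := by
  obtain ⟨p, hp⟩ := SimpleGraph.exists_walk_of_dist_ne_zero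
    (show G.dist y x₀ ≠ 0 by rw [SimpleGraph.dist_comm]; omega)
  rw [SimpleGraph.dist_comm, h] at hp
  cases p with
  | nil => simp at hp
  | @cons _ z _ hyz q =>
    have hq : G.dist x₀ z ≤ q.length := SimpleGraph.dist_comm (G := G) ▸ G.dist_le q
    have hadj := hyz.diff_dist_adj (u := x₀)
    rw [SimpleGraph.Walk.length_cons] at hp
    exact ⟨z, hyz.symm, by omega⟩

theorem finite_setOf_dist_le [G.LocallyFinite] (hG : G.Connected) (x₀ : V) (r : ℕ) :
    {x | G.dist x₀ x ≤ r}.Finite := by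
  induction r with
  | zero => simp [hG.dist_eq_zero_iff]
  | succ r ih =>
    refine (ih.union (ih.biUnion fun z _ => (G.neighborSet z).toFinite)).subset fun x hx => ?_
    rcases Nat.le_or_eq_of_le_succ hx with hle | heq
    · exact Or.inl hle
    · obtain ⟨z, hzx, hz⟩ := exists_adj_dist_eq_of_dist_eq_succ heq
      exact Or.inr (mem_biUnion hz.le hzx)

theorem tendsto_dist_cofinite [G.LocallyFinite] (hG : G.Connected) (x₀ : V) :
    Tendsto (G.dist x₀) cofinite atTop :=
  tendsto_atTop.2 fun r => eventually_cofinite.2 <|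
    (finite_setOf_dist_le hG x₀ r).subset fun _ hx => (not_le.1 hx).le

theorem finite_setOf_dist_eq [G.LocallyFinite] (hG : G.Connected) (x₀ : V) (r : ℕ) :
    {x | G.dist x₀ x = r}.Finite :=
  (finite_setOf_dist_le hG x₀ r).subset fun _ h => le_of_eq h

theorem exists_dist_eq [Infinite V] [G.LocallyFinite] (hG : G.Connected) (x₀ : V) (r : ℕ) :
    ∃ x, G.dist x₀ x = r := by
  obtain ⟨y, hy⟩ := ((tendsto_dist_cofinite hG x₀).eventually_ge_atTop r).exists
  refine Nat.decreasingInduction (motive := fun k _ => ∃ x, G.dist x₀ x = k) ?_ ⟨y, rfl⟩ hy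
  rintro k - ⟨z, hz⟩
  obtain ⟨w, -, hw⟩ := exists_adj_dist_eq_of_dist_eq_succ hz
  exact ⟨w, hw⟩

theorem sphereArea_pos [Infinite V] [G.LocallyFinite] (hG : G.Connected) (x₀ : V) (r : ℕ) :
    0 < G.sphereArea x₀ r :=
  (ncard_pos (finite_setOf_dist_eq hG x₀ r)).2 (exists_dist_eq hG x₀ r)

theorem ballVolume_succ (G : SimpleGraph V) (x₀ : V) (r : ℕ) :
    G.ballVolume x₀ (r + 1) = G.ballVolume x₀ r + G.sphereArea x₀ (r + 1) :=
  Finset.sum_range_succ _ _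

theorem outerDegree_eq_card_filter [G.LocallyFinite] (x₀ x : V) : G.outerDegree x₀ x =
    ((G.neighborFinset x).filter fun y => G.dist x₀ y = G.dist x₀ x + 1).card := by
  rw [SimpleGraph.outerDegree, ← ncard_coe_finset]
  simp

theorem innerDegree_eq_card_filter [G.LocallyFinite] (x₀ x : V) : G.innerDegree x₀ x =
    ((G.neighborFinset x).filter fun y => G.dist x₀ y + 1 = G.dist x₀ x).card := by
  rw [SimpleGraph.innerDegree, ← ncard_coe_finset]
  simp

theorem laplacian_comp_dist [G.LocallyFinite] (x₀ x : V) (h : ℕ → ℝ) :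
    G.laplacian (fun y => h (G.dist x₀ y)) x
      = G.outerDegree x₀ x * (h (G.dist x₀ x) - h (G.dist x₀ x + 1))
        + G.innerDegree x₀ x * (h (G.dist x₀ x) - h (G.dist x₀ x - 1)) := by
  rw [outerDegree_eq_card_filter, innerDegree_eq_card_filter, ← nsmul_eq_mul, ← nsmul_eq_mul,
    ← Finset.sum_const, ← Finset.sum_const, Finset.sum_filter, Finset.sum_filter,
    ← Finset.sum_add_distrib]
  refine Finset.sum_congr rfl fun y hy => ?_
  have hadj := ((G.mem_neighborFinset x y).1 hy).diff_dist_adj (u := x₀)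
  beta_reduce
  generalize G.dist x₀ y = a, G.dist x₀ x = b at hadj ⊢
  rcases hadj with rfl | rfl | rfl
  · simp
  · simp [show b + 1 + 1 ≠ b by omega]
  · rcases b with _ | b
    · simp
    · simp [show b ≠ b + 1 + 1 by omega]

end Spheres

section SphericallySymmetric

variable {V : Type*} {G : SimpleGraph V} {x₀ : V} {kPlus kMinus : ℕ → ℕ}

/-- The term `V(r) / (k₊(r) S(r))` of the series: the volume of the ball of radius `r` divided by
the number of edges leaving it. -/
noncomputable def volumeBoundaryRatio (G : SimpleGraph V) (x₀ : V) (kPlus : ℕ → ℕ) (r : ℕ) : ℝ :=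
  G.ballVolume x₀ r / (kPlus r * G.sphereArea x₀ r)

/-- The radial solution of `Δ v = -1` with `v x₀ = 0` on a spherically symmetric graph, given by the
partial sums of `volumeBoundaryRatio`. -/
noncomputable def radialPotential (G : SimpleGraph V) (x₀ : V) (kPlus : ℕ → ℕ) (x : V) : ℝ :=
  ∑ i ∈ Finset.range (G.dist x₀ x), volumeBoundaryRatio G x₀ kPlus i

theorem volumeBoundaryRatio_nonneg (G : SimpleGraph V) (x₀ : V) (kPlus : ℕ → ℕ) (r : ℕ) :
    0 ≤ volumeBoundaryRatio G x₀ kPlus r := by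
  unfold volumeBoundaryRatio
  positivity

theorem bddAbove_range_radialPotential (hsum : Summable (volumeBoundaryRatio G x₀ kPlus)) :
    BddAbove (range (radialPotential G x₀ kPlus)) := by
  refine ⟨∑' r, volumeBoundaryRatio G x₀ kPlus r, ?_⟩
  rintro _ ⟨x, rfl⟩
  exact hsum.sum_le_tsum _ fun r _ => volumeBoundaryRatio_nonneg G x₀ kPlus r

variable [G.LocallyFinite]

theorem tendsto_radialPotential_cofinite (hG : G.Connected)
    (hsum : ¬Summable (volumeBoundaryRatio G x₀ kPlus)) :
    Tendsto (radialPotential G x₀ kPlus) cofinite atTop :=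
  ((not_summable_iff_tendsto_nat_atTop_of_nonneg (volumeBoundaryRatio_nonneg G x₀ kPlus)).1
    hsum).comp (tendsto_dist_cofinite hG x₀)

theorem kPlus_pos [Infinite V] (hG : G.Connected)
    (hsym : G.IsSphericallySymmetric x₀ kPlus kMinus) (r : ℕ) : 0 < kPlus r := by
  obtain ⟨y, hy⟩ := exists_dist_eq hG x₀ (r + 1)
  obtain ⟨z, hzy, rfl⟩ := exists_adj_dist_eq_of_dist_eq_succ hy
  rw [← (hsym z).1, outerDegree_eq_card_filter]
  exact Finset.card_pos.2 ⟨y, by simp [hzy, hy]⟩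

theorem kPlus_mul_sphereArea (hG : G.Connected)
    (hsym : G.IsSphericallySymmetric x₀ kPlus kMinus) (r : ℕ) :
    kPlus r * G.sphereArea x₀ r = kMinus (r + 1) * G.sphereArea x₀ (r + 1) := by
  classical
  have hcard (r : ℕ) : G.sphereArea x₀ r = (finite_setOf_dist_eq hG x₀ r).toFinset.card :=
    ncard_eq_toFinset_card _ _
  rw [hcard, hcard, mul_comm, mul_comm (kMinus _)]
  refine Finset.card_mul_eq_card_mul G.Adj (fun x hx => ?_) fun y hy => ?_
  · obtain rfl : G.dist x₀ x = r := by simpa using hx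
    rw [← (hsym x).1, outerDegree_eq_card_filter]
    congr 1
    ext y
    simp [Finset.mem_bipartiteAbove, and_comm]
  · have hy' : G.dist x₀ y = r + 1 := by simpa using hy
    rw [← hy', ← (hsym y).2, innerDegree_eq_card_filter]
    congr 1
    ext x
    simp [Finset.mem_bipartiteBelow, hy', and_comm, G.adj_comm]

theorem kPlus_mul_volumeBoundaryRatio [Infinite V] (hG : G.Connected)
    (hsym : G.IsSphericallySymmetric x₀ kPlus kMinus) (r : ℕ) :
    kPlus r * volumeBoundaryRatio G x₀ kPlus r = G.ballVolume x₀ r / G.sphereArea x₀ r := by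
  have hk : (kPlus r : ℝ) ≠ 0 := Nat.cast_ne_zero.2 (kPlus_pos hG hsym r).ne'
  rw [volumeBoundaryRatio, mul_div_assoc', mul_div_mul_left _ _ hk]

theorem kMinus_succ_mul_volumeBoundaryRatio [Infinite V] (hG : G.Connected)
    (hsym : G.IsSphericallySymmetric x₀ kPlus kMinus) (r : ℕ) :
    kMinus (r + 1) * volumeBoundaryRatio G x₀ kPlus r
      = G.ballVolume x₀ r / G.sphereArea x₀ (r + 1) := by
  have hedges : (kPlus r : ℝ) * G.sphereArea x₀ r = kMinus (r + 1) * G.sphereArea x₀ (r + 1) := by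
    exact_mod_cast kPlus_mul_sphereArea hG hsym r
  have hpos : 0 < kMinus (r + 1) * G.sphereArea x₀ (r + 1) :=
    kPlus_mul_sphereArea hG hsym r ▸ Nat.mul_pos (kPlus_pos hG hsym r) (sphereArea_pos hG x₀ r)
  have hk : (kMinus (r + 1) : ℝ) ≠ 0 := Nat.cast_ne_zero.2 (Nat.pos_of_mul_pos_right hpos).ne'
  rw [volumeBoundaryRatio, hedges, mul_div_assoc', mul_div_mul_left _ _ hk]

theorem laplacian_radialPotential [Infinite V] (hG : G.Connected)
    (hsym : G.IsSphericallySymmetric x₀ kPlus kMinus) (x : V) :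
    G.laplacian (radialPotential G x₀ kPlus) x = -1 := by
  have hS (r : ℕ) : (G.sphereArea x₀ r : ℝ) ≠ 0 :=
    Nat.cast_ne_zero.2 (sphereArea_pos hG x₀ r).ne'
  unfold radialPotential
  rw [laplacian_comp_dist x₀ x fun r => ∑ i ∈ Finset.range r, volumeBoundaryRatio G x₀ kPlus i,
    (hsym x).1, (hsym x).2, Finset.sum_range_succ, sub_add_cancel_left, mul_neg,
    kPlus_mul_volumeBoundaryRatio hG hsym]
  rcases G.dist x₀ x with _ | r
  · simp [SimpleGraph.ballVolume, hS 0]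
  · rw [Nat.add_sub_cancel, Finset.sum_range_succ, add_sub_cancel_left,
      kMinus_succ_mul_volumeBoundaryRatio hG hsym, ballVolume_succ, Nat.cast_add, add_div,
      div_self (hS _)]
    ring

end SphericallySymmetric

end StochasticCompleteness

theorem theorem4p3 {V : Type*} [Infinite V] (G : SimpleGraph V) [G.LocallyFinite]
    (hG : G.Connected) (x₀ : V) (kPlus kMinus : ℕ → ℕ)
    (hsym : G.IsSphericallySymmetric x₀ kPlus kMinus) :
    G.StochasticallyIncomplete ↔
      Summable (fun r : ℕ =>
        (G.ballVolume x₀ r : ℝ) / ((kPlus r : ℝ) * (G.sphereArea x₀ r : ℝ))) := by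
  open StochasticCompleteness in
  have hΔ := laplacian_radialPotential hG hsym
  have : Nonempty V := ⟨x₀⟩
  refine ⟨fun hinc => ?_, fun hsum => ?_⟩
  · by_contra hsum
    exact not_stochasticallyIncomplete_of_neg_one_le_laplacian (fun x => (hΔ x).ge)
      (tendsto_radialPotential_cofinite hG hsum) hinc
  · exact stochasticallyIncomplete_of_laplacian_le_neg_one (fun x => (hΔ x).le)
      (bddAbove_range_radialPotential hsum)
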